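/- Let $n\ge 5$. A triangulation of a convex $n$-gon is a set of $n-3$ pairwise non-crossing diagonals; it divides the polygon into $n-2$ triangles, and a triangle of the triangulation is called an ear if two of its sides are sides of the $n$-gon. Let $\mathcal{A}_n$ be the associahedron graph: its vertices are the triangulations of the convex $n$-gon, and two distinct triangulations are adjacent if and only if they share $n-4$ diagonals. Let $T$ be a triangulation of the convex $n$-gon and let $t_1$ be the number of ears of $T$. Then the number of cycles of length $5$ in $\mathcal{A}_n$ (subgraphs of $\mathcal{A}_n$ isomorphic to the cycle graph $C_5$) that contain $T$ is exactly $n-6+t_1$, and $n-6+t_1\ge n-4$. -/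

import Mathlib

namespace Associahedron

/-- The vertices of a convex `n`-gon are labelled `0, 1, …, n - 1` in cyclic order by `Fin n`.
A segment between two distinct vertices is represented by the pair `(i, j)` of its end points
with `i < j`. It is a side of the polygon if its end points are cyclically consecutive. -/
def IsSide {n : ℕ} (e : Fin n × Fin n) : Prop :=
  e.1 < e.2 ∧ (e.1.val + 1 = e.2.val ∨ (e.1.val = 0 ∧ e.2.val + 1 = n))

/-- A diagonal: a segment between two distinct vertices that is not a side. -/
def IsDiagonal {n : ℕ} (e : Fin n × Fin n) : Prop :=
  e.1 < e.2 ∧ ¬ IsSide e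

/-- Two segments between vertices of a convex polygon cross (in a point that is interior to both)
iff their end points strictly interleave in the cyclic order. -/
def Crosses {n : ℕ} (e f : Fin n × Fin n) : Prop :=
  (e.1 < f.1 ∧ f.1 < e.2 ∧ e.2 < f.2) ∨ (f.1 < e.1 ∧ e.1 < f.2 ∧ f.2 < e.2)

instance {n : ℕ} (e : Fin n × Fin n) : Decidable (IsSide e) := by
  unfold IsSide; infer_instance

instance {n : ℕ} (e : Fin n × Fin n) : Decidable (IsDiagonal e) := by
  unfold IsDiagonal; infer_instance

instance {n : ℕ} (e f : Fin n × Fin n) : Decidable (Crosses e f) := by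
  unfold Crosses; infer_instance

/-- A triangulation of the convex `n`-gon: a set of `n - 3` pairwise non-crossing diagonals. -/
@[ext]
structure Triangulation (n : ℕ) where
  diagonals : Finset (Fin n × Fin n)
  isDiagonal : ∀ e ∈ diagonals, IsDiagonal e
  not_crosses : ∀ e ∈ diagonals, ∀ f ∈ diagonals, ¬ Crosses e f
  card_diagonals : diagonals.card + 3 = n

/-- The associahedron graph (flip graph): the vertices are the triangulations of the convex
`n`-gon; two distinct triangulations are adjacent iff they share exactly `n - 4` diagonals. -/
def flipGraph (n : ℕ) : SimpleGraph (Triangulation n) where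
  Adj S T := S ≠ T ∧ (S.diagonals ∩ T.diagonals).card + 4 = n
  symm := ⟨fun S T h => ⟨h.1.symm, by rw [Finset.inter_comm]; exact h.2⟩⟩
  loopless := ⟨fun _ h => h.1 rfl⟩

/-- The three sides of the triangle with vertices `i < j < k`, given as `(i, j, k)`. -/
def triangleSides {n : ℕ} (t : Fin n × Fin n × Fin n) : Finset (Fin n × Fin n) :=
  {(t.1, t.2.1), (t.2.1, t.2.2), (t.1, t.2.2)}

/-- The triangles of a triangulation `T`: the triples `i < j < k` of vertices such that each of
the three segments joining them is a side of the polygon or a diagonal of `T`. -/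
def Triangulation.triangles {n : ℕ} (T : Triangulation n) : Finset (Fin n × Fin n × Fin n) :=
  {t | t.1 < t.2.1 ∧ t.2.1 < t.2.2 ∧ ∀ e ∈ triangleSides t, IsSide e ∨ e ∈ T.diagonals}

/-- The ears of `T`: the triangles of `T` with two sides that are sides of the polygon. -/
def Triangulation.ears {n : ℕ} (T : Triangulation n) : Finset (Fin n × Fin n × Fin n) :=
  {t ∈ T.triangles | ((triangleSides t).filter IsSide).card = 2}

/-- The cycles of length `k` (for `k ≥ 3`) of a graph `G` that contain the vertex `v`: the
subgraphs of `G` that are isomorphic to the cycle graph on `k` vertices and contain `v`. -/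
def cyclesThrough {V : Type*} (G : SimpleGraph V) (k : ℕ) (v : V) : Set G.Subgraph :=
  {H | Nonempty (H.coe ≃g SimpleGraph.cycleGraph k) ∧ v ∈ H.verts}

end Associahedron

/-! ### Non-crossing sets of diagonals and the triangles on an edge -/

namespace Associahedron

variable {n : ℕ}

/-! A 5-cycle through `T` leaves `T` along the flips of two distinct diagonals `a` and `b`. Its two
remaining vertices are adjacent, which forces them to be the double flips "`a`, then `b`" and "`b`,
then `a`" (`eq_of_adj_flip_flip`). If the new diagonals `a'` and `b'` do not cross, the flips
commute and these two vertices coincide. If they cross, `a` and `b` are sides of a common triangle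
(`neighbors_iff_crosses`), and the cycle is the flip cycle of the pentagon made of the three
triangles at `a` and `b`. So the 5-cycles correspond to the unordered pairs of diagonals in a common
triangle (`bijOn_flippedDiagonals`).

A triangle with `k` diagonal sides contributes `k.choose 2 = 2k - 3 + [k = 1]` pairs, where `1 ≤ k ≤
3`. There are `n - 2` triangles, each diagonal lies in two of them, and `k = 1` means an ear, so the
total is `4(n - 3) - 3(n - 2) + t₁ = n - 6 + t₁`. Summing `k + [k = 1] ≥ 2` gives `t₁ ≥ 2`. -/

theorem Crosses.symm {e f : Fin n × Fin n} (h : Crosses e f) : Crosses f e := by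
  unfold Crosses at *; omega

theorem IsSide.not_crosses {e f : Fin n × Fin n} (h : IsSide e) : ¬ Crosses e f := by
  unfold IsSide at h; unfold Crosses; omega

theorem not_crosses_self (e : Fin n × Fin n) : ¬ Crosses e e := by
  unfold Crosses; omega

/-- Pairwise non-crossing diagonals of a convex `n`-gon number at most `n - 3`: sending each
diagonal `(i, j)`, and the side `(0, n - 1)`, to the largest `m` strictly between `i` and `j`
that is joined to `i` is injective. -/
theorem card_add_three_le (hn : 3 ≤ n) (S : Finset (Fin n × Fin n))
    (hd : ∀ e ∈ S, IsDiagonal e) (hc : ∀ e ∈ S, ∀ f ∈ S, ¬ Crosses e f) :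
    S.card + 3 ≤ n := by
  classical
  let r : Fin n × Fin n := (⟨0, by omega⟩, ⟨n - 1, by omega⟩)
  have hr : r ∉ S := fun h => by
    have := hd _ h
    simp only [IsDiagonal, IsSide, r, Fin.lt_def, true_and] at this
    omega
  have hlong : ∀ e ∈ insert r S, e.1.val + 2 ≤ e.2.val := by
    intro e he
    rcases Finset.mem_insert.1 he with rfl | he
    · simp only [r]; omega
    · have := hd _ he
      simp only [IsDiagonal, IsSide] at this
      omega
  have hcr : ∀ e ∈ insert r S, ∀ f ∈ insert r S, ¬ Crosses e f := by
    have h0 : IsSide r := by simp only [IsSide, r, Fin.lt_def, true_and]; omega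
    intro e he f hf
    rcases Finset.mem_insert.1 he with rfl | he
    · exact h0.not_crosses
    rcases Finset.mem_insert.1 hf with rfl | hf
    · exact fun h => h0.not_crosses h.symm
    exact hc e he f hf
  have hex : ∀ e : Fin n × Fin n, ∃ m : Fin n, e ∈ insert r S →
      e.1 < m ∧ m < e.2 ∧ (e.1.val + 1 = m.val ∨ (e.1, m) ∈ S) ∧
        ∀ m', m' < e.2 → (e.1, m') ∈ S → m' ≤ m := by
    intro e
    by_cases he : e ∈ insert r S
    · have hl := hlong e he
      let M : Finset (Fin n) :=
        {m | e.1 < m ∧ m < e.2 ∧ (e.1.val + 1 = m.val ∨ (e.1, m) ∈ S)}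
      have hM : M.Nonempty := ⟨⟨e.1.val + 1, by omega⟩, by
        simp only [M, Finset.mem_filter, Finset.mem_univ, true_and, Fin.lt_def]
        exact ⟨by omega, by omega, Or.inl trivial⟩⟩
      obtain ⟨m, hm, hmax⟩ := M.exists_max_image id hM
      simp only [M, Finset.mem_filter, Finset.mem_univ, true_and, id] at hm hmax
      refine ⟨m, fun _ => ⟨hm.1, hm.2.1, hm.2.2, fun m' h1 h2 => hmax m' ⟨?_, h1, Or.inr h2⟩⟩⟩
      exact (hd _ h2).1
    · exact ⟨e.1, fun h => absurd h he⟩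
  choose f hf using hex
  have hinj : Set.InjOn f (insert r S : Finset (Fin n × Fin n)) := by
    intro e he e' he' hee
    have key : ∀ e ∈ insert r S, ∀ e' ∈ insert r S, f e = f e' → e.1 ≤ e'.1 → e'.2 ≤ e.2 →
        e = e' := by
      rintro e he e' he' hee h1 h2
      obtain ⟨a1, a2, a3, a4⟩ := hf e he
      obtain ⟨b1, b2, b3, b4⟩ := hf e' he'
      rw [← hee] at b1 b2 b3 b4
      -- If `e` started strictly before `e'`, then `m` would not be the successor of `e.1`, so
      -- `(e.1, m)` would be a diagonal, and it would cross `e'`.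
      have h3 : e.1 = e'.1 := by
        by_contra h3
        rcases a3 with a3 | a3
        · omega
        · apply hcr _ (Finset.mem_insert_of_mem a3) e' he'
          simp only [Crosses]
          omega
      refine Prod.ext h3 ?_
      -- Now `e'` is a shorter diagonal from the same vertex, so maximality of `m` gives `e'.2 ≤ m`,
      -- although `m < e'.2`.
      by_contra h4
      have h5 : e' ∈ S := by
        rcases Finset.mem_insert.1 he' with rfl | h5
        · exfalso
          simp only [r, Fin.ext_iff, Fin.le_def] at h2 h4
          omega
        · exact h5
      have := a4 e'.2 (by omega) (by rw [h3]; exact h5)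
      omega
    have hx := hcr _ he _ he'
    simp only [Crosses] at hx
    obtain ⟨a1, a2, -, -⟩ := hf e he
    obtain ⟨b1, b2, -, -⟩ := hf e' he'
    rw [← hee] at b1 b2
    have : (e.1 ≤ e'.1 ∧ e'.2 ≤ e.2) ∨ (e'.1 ≤ e.1 ∧ e.2 ≤ e'.2) := by omega
    rcases this with h | h
    · exact key e he e' he' hee h.1 h.2
    · exact (key e' he' e he hee.symm h.1 h.2).symm
  have hmap : Set.MapsTo f (insert r S : Finset (Fin n × Fin n))
      (Finset.Ioo r.1 r.2 : Finset (Fin n)) := by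
    intro e he
    obtain ⟨a1, a2, -, -⟩ := hf e he
    simp only [Finset.coe_Ioo, Set.mem_Ioo, r, Fin.lt_def] at *
    omega
  -- The `n - 2` vertices other than `0` and `n - 1` bound the diagonals together with the extra
  -- element `r`.
  have := Finset.card_le_card_of_injOn f hmap hinj
  rw [Finset.card_insert_of_notMem hr, Fin.card_Ioo] at this
  simp only [r] at this
  omega

namespace Triangulation

variable (T : Triangulation n)

theorem three_le (T : Triangulation n) : 3 ≤ n := by have := T.card_diagonals; omega

/-- Maximality: adjoining a new non-crossing diagonal would exceed the bound `n - 3`. -/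
theorem mem_of_forall_not_crosses {d : Fin n × Fin n} (hd : IsDiagonal d)
    (h : ∀ e ∈ T.diagonals, ¬ Crosses d e) : d ∈ T.diagonals := by
  by_contra hm
  have := card_add_three_le T.three_le (insert d T.diagonals)
    (by
      intro e he
      rcases Finset.mem_insert.1 he with rfl | he
      exacts [hd, T.isDiagonal e he])
    (by
      intro e he f hf
      rcases Finset.mem_insert.1 he with rfl | he' <;> rcases Finset.mem_insert.1 hf with rfl | hf'
      · exact not_crosses_self _
      · exact h f hf'
      · exact fun hc => h e he' hc.symm
      · exact T.not_crosses e he' f hf')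
  rw [Finset.card_insert_of_notMem hm] at this
  have := T.card_diagonals
  omega

/-- The edges of a triangulated polygon: its sides and the diagonals of the triangulation. -/
def Edge (i j : Fin n) : Prop := IsSide (i, j) ∨ (i, j) ∈ T.diagonals

variable {T}

theorem Edge.lt {i j : Fin n} (h : T.Edge i j) : i < j :=
  h.elim (fun h => h.1) (fun h => (T.isDiagonal _ h).1)

theorem Edge.not_crosses {i j k l : Fin n} (h : T.Edge i j) (h' : T.Edge k l) :
    ¬ Crosses (i, j) (k, l) := by
  rcases h with h | h
  · exact h.not_crosses
  rcases h' with h' | h'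
  · exact fun hc => h'.not_crosses hc.symm
  exact T.not_crosses _ h _ h'

theorem edge_of_forall {i j : Fin n} (hij : i < j)
    (h : ∀ k l, T.Edge k l → ¬ Crosses (i, j) (k, l)) : T.Edge i j := by
  by_cases hs : IsSide (i, j)
  · exact Or.inl hs
  · exact Or.inr (T.mem_of_forall_not_crosses ⟨hij, hs⟩ fun e he => h e.1 e.2 (Or.inr he))

theorem edge_succ {i j : Fin n} (h : i.val + 1 = j.val) : T.Edge i j :=
  Or.inl ⟨by simp only; omega, Or.inl h⟩

/-- Take `m` as the last vertex before `j` joined to `i`. An edge crossing `(m, j)` but neither `(i,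
m)` nor `(i, j)` would join `i` to a vertex between `m` and `j`; hence `(m, j)` is an edge by
maximality of `T`. -/
theorem Edge.exists_inner {i j : Fin n} (h : T.Edge i j) (hij : i.val + 2 ≤ j.val) :
    ∃ m, i < m ∧ m < j ∧ T.Edge i m ∧ T.Edge m j := by
  classical
  let M : Finset (Fin n) := {m | m < j ∧ T.Edge i m}
  have hM : M.Nonempty := ⟨⟨i.val + 1, by omega⟩, by
    simp only [M, Finset.mem_filter, Finset.mem_univ, true_and, Fin.lt_def]
    exact ⟨by omega, edge_succ rfl⟩⟩
  obtain ⟨m, hm, hmax⟩ := M.exists_max_image id hM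
  simp only [M, Finset.mem_filter, Finset.mem_univ, true_and, id] at hm hmax
  refine ⟨m, hm.2.lt, hm.1, hm.2, edge_of_forall hm.1 fun p q hpq => ?_⟩
  have h1 := h.not_crosses hpq
  have h2 := hm.2.not_crosses hpq
  have h3 := hm.2.lt
  have h4 : p = i → q < j → q ≤ m := fun h5 h6 => hmax q ⟨h6, h5 ▸ hpq⟩
  simp only [Crosses] at h1 h2 ⊢
  omega

/-- Take the inner triangle of the shortest edge properly spanning `(i, j)`. Its apex is not
strictly between `i` and `j`, so one of its two shorter sides spans `(i, j)` and by minimality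
equals it. Only `(0, n - 1)` has no spanning edge. -/
theorem Edge.exists_outer {i j : Fin n} (h : T.Edge i j) (hij : ¬ (i.val = 0 ∧ j.val + 1 = n)) :
    ∃ k, (k < i ∧ T.Edge k i ∧ T.Edge k j) ∨ (j < k ∧ T.Edge i k ∧ T.Edge j k) := by
  classical
  let M : Finset (Fin n × Fin n) := {e | T.Edge e.1 e.2 ∧ e.1 ≤ i ∧ j ≤ e.2 ∧ e ≠ (i, j)}
  have h3 := T.three_le
  have hM : M.Nonempty := ⟨(⟨0, by omega⟩, ⟨n - 1, by omega⟩), by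
    simp only [M, Finset.mem_filter, Finset.mem_univ, true_and, Fin.le_def, ne_eq,
      Prod.ext_iff, Fin.ext_iff]
    refine ⟨Or.inl ?_, by omega, by omega, by omega⟩
    simp only [IsSide, Fin.lt_def, true_and]
    omega⟩
  obtain ⟨⟨p, q⟩, hm, hmin⟩ := M.exists_min_image (fun e => e.2.val - e.1.val) hM
  simp only [M, Finset.mem_filter, Finset.mem_univ, true_and, and_imp, Prod.forall, ne_eq,
    Prod.ext_iff] at hm hmin
  obtain ⟨hpq, hpi, hjq, hne⟩ := hm
  have hlt := h.lt
  obtain ⟨m, hpm, hmq, h1, h2⟩ := hpq.exists_inner (by omega)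
  have c1 := h1.not_crosses h
  have c2 := h2.not_crosses h
  simp only [Crosses] at c1 c2
  rcases (by omega : j ≤ m ∨ m ≤ i) with hm | hm
  · have : p = i ∧ m = j := by
      by_contra hx
      have := hmin p m h1 hpi hm hx
      omega
    obtain ⟨rfl, rfl⟩ := this
    exact ⟨q, Or.inr ⟨hmq, hpq, h2⟩⟩
  · have : m = i ∧ q = j := by
      by_contra hx
      have := hmin m q h2 hm hjq hx
      omega
    obtain ⟨rfl, rfl⟩ := this
    exact ⟨p, Or.inl ⟨hpm, h1, hpq⟩⟩

end Triangulation
end Associahedron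

/-! ### Flips, quadrilaterals and pentagons -/

namespace Associahedron

variable {n : ℕ}

namespace Triangulation

variable {T : Triangulation n}

/-- `d` is the diagonal that replaces the diagonal `a` of `T` when `a` is flipped. -/
structure IsFlip (T : Triangulation n) (a d : Fin n × Fin n) : Prop where
  mem : a ∈ T.diagonals
  isDiagonal : IsDiagonal d
  notMem : d ∉ T.diagonals
  eq_of_crosses : ∀ e ∈ T.diagonals, Crosses d e → e = a

theorem IsFlip.crosses {a d : Fin n × Fin n} (h : T.IsFlip a d) : Crosses d a := by
  by_contra hc
  refine h.notMem (T.mem_of_forall_not_crosses h.isDiagonal fun e he hde => hc ?_)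
  rwa [← h.eq_of_crosses e he hde]

theorem IsFlip.not_crosses {a d : Fin n × Fin n} (h : T.IsFlip a d) {u v : Fin n}
    (huv : T.Edge u v) (hne : (u, v) ≠ a) : ¬ Crosses d (u, v) := by
  rcases huv with huv | huv
  · exact fun hc => huv.not_crosses hc.symm
  · exact fun hc => hne (h.eq_of_crosses _ huv hc)

/-- The edge from `i` to `j` has the triangles with apices `m` (between `i` and `j`) and `k`
(outside) on its two sides. -/
def IsQuad (T : Triangulation n) (i m j k : Fin n) : Prop :=
  i < m ∧ m < j ∧ T.Edge i m ∧ T.Edge m j ∧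
    ((k < i ∧ T.Edge k i ∧ T.Edge k j) ∨ (j < k ∧ T.Edge i k ∧ T.Edge j k))

theorem two_le_of_mem {i j : Fin n} (h : (i, j) ∈ T.diagonals) :
    i.val + 2 ≤ j.val ∧ ¬ (i.val = 0 ∧ j.val + 1 = n) := by
  have := T.isDiagonal _ h
  simp only [IsDiagonal, IsSide] at this
  omega

theorem exists_isQuad {i j : Fin n} (h : (i, j) ∈ T.diagonals) : ∃ m k, T.IsQuad i m j k := by
  obtain ⟨h1, h2⟩ := two_le_of_mem h
  obtain ⟨m, hm⟩ := Edge.exists_inner (Or.inr h) h1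
  obtain ⟨k, hk⟩ := Edge.exists_outer (Or.inr h) h2
  exact ⟨m, k, hm.1, hm.2.1, hm.2.2.1, hm.2.2.2, hk⟩

theorem isDiagonal_of_crosses {d : Fin n × Fin n} {i j : Fin n} (hd : d.1 < d.2)
    (h : Crosses d (i, j)) : IsDiagonal d :=
  ⟨hd, fun hs => hs.not_crosses h⟩

theorem isFlip_of_crosses {i j : Fin n} {d : Fin n × Fin n} (h : (i, j) ∈ T.diagonals)
    (hd : d.1 < d.2) (hc : Crosses d (i, j))
    (hn : ∀ u v, T.Edge u v → Crosses d (u, v) → u = i ∧ v = j) : T.IsFlip (i, j) d where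
  mem := h
  isDiagonal := isDiagonal_of_crosses hd hc
  notMem := fun hm => T.not_crosses _ hm _ h hc
  eq_of_crosses := fun e he hde => Prod.ext (hn e.1 e.2 (Or.inr he) hde).1
    (hn e.1 e.2 (Or.inr he) hde).2

/-- The two triangles at `a` form a quadrilateral. Its other diagonal is the flip: any edge crossing
it, other than `a`, would cross one of the four sides. -/
theorem exists_isFlip {a : Fin n × Fin n} (h : a ∈ T.diagonals) : ∃ d, T.IsFlip a d := by
  obtain ⟨i, j⟩ := a
  obtain ⟨m, k, h1, h2, h3, h4, ⟨h5, h6, h7⟩ | ⟨h5, h6, h7⟩⟩ := exists_isQuad h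
  · refine ⟨(k, m), isFlip_of_crosses h (by simp only; omega) (by simp only [Crosses]; omega) ?_⟩
    intro u v huv
    have c1 := h3.not_crosses huv
    have c2 := h4.not_crosses huv
    have c3 := h6.not_crosses huv
    have c4 := h7.not_crosses huv
    have := huv.lt
    simp only [Crosses] at *
    omega
  · refine ⟨(m, k), isFlip_of_crosses h (by simp only; omega) (by simp only [Crosses]; omega) ?_⟩
    intro u v huv
    have c1 := h3.not_crosses huv
    have c2 := h4.not_crosses huv
    have c3 := h6.not_crosses huv
    have c4 := h7.not_crosses huv
    have := huv.lt
    simp only [Crosses] at *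
    omega

theorem IsFlip.eq_of_isQuad {i m j k : Fin n} {d : Fin n × Fin n} (h : T.IsFlip (i, j) d)
    (hq : T.IsQuad i m j k) : (k < i ∧ d = (k, m)) ∨ (j < k ∧ d = (m, k)) := by
  obtain ⟨x, y⟩ := d
  have c0 := h.crosses
  have hxy : x < y := h.isDiagonal.1
  obtain ⟨h1, h2, h3, h4, ⟨h5, h6, h7⟩ | ⟨h5, h6, h7⟩⟩ := hq
  all_goals
    have c1 := h.not_crosses h3 (by simp only [ne_eq, Prod.mk.injEq]; omega)
    have c2 := h.not_crosses h4 (by simp only [ne_eq, Prod.mk.injEq]; omega)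
    have c3 := h.not_crosses h6 (by simp only [ne_eq, Prod.mk.injEq]; omega)
    have c4 := h.not_crosses h7 (by simp only [ne_eq, Prod.mk.injEq]; omega)
    simp only [Crosses, Prod.mk.injEq] at *
    omega

theorem IsFlip.unique {a d d' : Fin n × Fin n} (h : T.IsFlip a d) (h' : T.IsFlip a d') :
    d = d' := by
  obtain ⟨i, j⟩ := a
  obtain ⟨m, k, hq⟩ := exists_isQuad h.mem
  have hij := hq.1.trans hq.2.1
  rcases h.eq_of_isQuad hq with ⟨h1, rfl⟩ | ⟨h1, rfl⟩ <;>
    rcases h'.eq_of_isQuad hq with ⟨h2, rfl⟩ | ⟨h2, rfl⟩ <;> first | rfl | omega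

theorem IsFlip.eq_of_eq {a b d : Fin n × Fin n} (h : T.IsFlip a d) (h' : T.IsFlip b d) :
    a = b :=
  (h.eq_of_crosses b h'.mem h'.crosses).symm

theorem mem_triangles {i j k : Fin n} :
    (i, j, k) ∈ T.triangles ↔ T.Edge i j ∧ T.Edge j k ∧ T.Edge i k := by
  simp only [triangles, triangleSides, Finset.mem_filter, Finset.mem_univ, true_and,
    Finset.mem_insert, Finset.mem_singleton, forall_eq_or_imp, forall_eq]
  exact ⟨fun h => h.2.2, fun h => ⟨Edge.lt h.1, Edge.lt h.2.1, h⟩⟩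

/-- Two diagonals of `T` are neighbours if they are sides of a common triangle of `T`. -/
def Neighbors (T : Triangulation n) (a b : Fin n × Fin n) : Prop :=
  ∃ t ∈ T.triangles, a ∈ triangleSides t ∧ b ∈ triangleSides t

/-- If `b` is not a side of the quadrilateral around `a`, then `b'` crosses neither its sides nor
`a`, so it cannot cross the other diagonal `a'`. -/
theorem neighbors_of_crosses {a b a' b' : Fin n × Fin n} (ha : T.IsFlip a a')
    (hb : T.IsFlip b b') (hab : a ≠ b) (hc : Crosses a' b') : T.Neighbors a b := by
  obtain ⟨i, j⟩ := a
  obtain ⟨p, q⟩ := b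
  obtain ⟨x, y⟩ := b'
  have hij : T.Edge i j := Or.inr ha.mem
  have hxy : x < y := hb.isDiagonal.1
  -- The segment `a` itself crosses `a'` and none of the four sides, so `b' = a` has to be excluded
  -- separately.
  have hne : ¬ (x = i ∧ y = j) := fun h => hb.notMem (by rw [h.1, h.2]; exact ha.mem)
  obtain ⟨m, k, hq⟩ := exists_isQuad ha.mem
  have hd := ha.eq_of_isQuad hq
  obtain ⟨h1, h2, h3, h4, h5⟩ := hq
  by_contra hN
  have t1 : ∀ u v w, T.Edge u v → T.Edge v w → T.Edge u w → (i, j) ∈ triangleSides (u, v, w) →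
      (p, q) ∉ triangleSides (u, v, w) := fun u v w e1 e2 e3 e4 e5 =>
    hN ⟨(u, v, w), mem_triangles.2 ⟨e1, e2, e3⟩, e4, e5⟩
  simp only [triangleSides, Finset.mem_insert, Finset.mem_singleton, Prod.mk.injEq] at t1
  have t2 := t1 i m j h3 h4 hij (by simp)
  have c0 := hb.not_crosses hij hab
  have c1 := hb.not_crosses h3 (by simp only [ne_eq, Prod.mk.injEq]; omega)
  have c2 := hb.not_crosses h4 (by simp only [ne_eq, Prod.mk.injEq]; omega)
  rcases h5 with ⟨h5, h6, h7⟩ | ⟨h5, h6, h7⟩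
  · have t3 := t1 k i j h6 hij h7 (by simp)
    have c3 := hb.not_crosses h6 (by simp only [ne_eq, Prod.mk.injEq]; omega)
    have c4 := hb.not_crosses h7 (by simp only [ne_eq, Prod.mk.injEq]; omega)
    have hd' : a' = (k, m) := hd.elim And.right (fun h => by omega)
    subst hd'
    clear hd t1 t2 t3 hab
    simp only [Crosses] at c0 c1 c2 c3 c4 hc
    omega
  · have t3 := t1 i j k hij h7 h6 (by simp)
    have c3 := hb.not_crosses h6 (by simp only [ne_eq, Prod.mk.injEq]; omega)
    have c4 := hb.not_crosses h7 (by simp only [ne_eq, Prod.mk.injEq]; omega)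
    have hd' : a' = (m, k) := hd.elim (fun h => by omega) And.right
    subst hd'
    clear hd t1 t2 t3 hab
    simp only [Crosses] at c0 c1 c2 c3 c4 hc
    omega

/-- `c` is the diagonal that crosses both of the diagonals `a` and `b` of `T` and no other. -/
structure IsDoubleFlip (T : Triangulation n) (a b c : Fin n × Fin n) : Prop where
  lt : c.1 < c.2
  crosses_left : Crosses c a
  crosses_right : Crosses c b
  eq_or_eq : ∀ e ∈ T.diagonals, Crosses c e → e = a ∨ e = b

theorem IsDoubleFlip.symm {a b c : Fin n × Fin n} (h : T.IsDoubleFlip a b c) :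
    T.IsDoubleFlip b a c :=
  ⟨h.lt, h.crosses_right, h.crosses_left, fun e he hc => (h.eq_or_eq e he hc).symm⟩

theorem IsDoubleFlip.not_crosses {a b d : Fin n × Fin n} (h : T.IsDoubleFlip a b d) {u v : Fin n}
    (huv : T.Edge u v) (ha : (u, v) ≠ a) (hb : (u, v) ≠ b) : ¬ Crosses d (u, v) := by
  rcases huv with huv | huv
  · exact fun hc => huv.not_crosses hc.symm
  · exact fun hc => (h.eq_or_eq _ huv hc).elim ha hb

/-- The flips of two neighbouring diagonals cross, and at most one diagonal crosses both. -/
def IsPentagon (T : Triangulation n) (a b : Fin n × Fin n) : Prop :=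
  (∀ a' b', T.IsFlip a a' → T.IsFlip b b' → Crosses a' b') ∧
    ∃ c₀, ∀ c, T.IsDoubleFlip a b c → c = c₀

theorem IsPentagon.symm {a b : Fin n × Fin n} (h : T.IsPentagon a b) : T.IsPentagon b a :=
  ⟨fun a' b' ha hb => (h.1 b' a' hb ha).symm, h.2.imp fun _ hc c h' => hc c h'.symm⟩

/-- With apices `p` and `q` beyond the two diagonals, the pentagon is `i, p, j, q, k`. The flips are
`(p, k)` and `(i, q)`, and `(p, q)` is the only segment that crosses both diagonals but none of the
five sides. -/
theorem isPentagon_left_right {i j k : Fin n} (hij : (i, j) ∈ T.diagonals)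
    (hjk : (j, k) ∈ T.diagonals) (hik : T.Edge i k) : T.IsPentagon (i, j) (j, k) := by
  obtain ⟨p, p1, p2, p3, p4⟩ := Edge.exists_inner (Or.inr hij) (two_le_of_mem hij).1
  obtain ⟨q, q1, q2, q3, q4⟩ := Edge.exists_inner (Or.inr hjk) (two_le_of_mem hjk).1
  constructor
  · intro a' b' ha hb
    rcases ha.eq_of_isQuad ⟨p1, p2, p3, p4, Or.inr ⟨by omega, hik, Or.inr hjk⟩⟩ with h | ⟨-, rfl⟩
    · omega
    rcases hb.eq_of_isQuad ⟨q1, q2, q3, q4, Or.inl ⟨by omega, Or.inr hij, hik⟩⟩ with ⟨-, rfl⟩ | h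
    · simp only [Crosses]; omega
    · omega
  · refine ⟨(p, q), fun ⟨x, y⟩ hc => ?_⟩
    have h0 := hc.lt
    have h1 := hc.crosses_left
    have h2 := hc.crosses_right
    have c1 := hc.not_crosses p3 (by simp only [ne_eq, Prod.mk.injEq]; omega)
      (by simp only [ne_eq, Prod.mk.injEq]; omega)
    have c2 := hc.not_crosses p4 (by simp only [ne_eq, Prod.mk.injEq]; omega)
      (by simp only [ne_eq, Prod.mk.injEq]; omega)
    have c3 := hc.not_crosses q3 (by simp only [ne_eq, Prod.mk.injEq]; omega)
      (by simp only [ne_eq, Prod.mk.injEq]; omega)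
    have c4 := hc.not_crosses q4 (by simp only [ne_eq, Prod.mk.injEq]; omega)
      (by simp only [ne_eq, Prod.mk.injEq]; omega)
    have c5 := hc.not_crosses hik (by simp only [ne_eq, Prod.mk.injEq]; omega)
      (by simp only [ne_eq, Prod.mk.injEq]; omega)
    simp only [Crosses, Prod.mk.injEq] at *
    omega

theorem isPentagon_left_top {i j k : Fin n} (hij : (i, j) ∈ T.diagonals)
    (hjk : T.Edge j k) (hik : (i, k) ∈ T.diagonals) : T.IsPentagon (i, j) (i, k) := by
  obtain ⟨p, p1, p2, p3, p4⟩ := Edge.exists_inner (Or.inr hij) (two_le_of_mem hij).1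
  obtain ⟨r, hr⟩ := Edge.exists_outer (Or.inr hik) (two_le_of_mem hik).2
  have hlt := hjk.lt
  -- The outer apex `r` may precede `i` or follow `k`, so the segment joining it to `p` has to be
  -- put in increasing order.
  have hd : ∃ c₀, (r < i ∧ c₀ = (r, p)) ∨ (k < r ∧ c₀ = (p, r)) := by
    rcases hr with hr | hr
    · exact ⟨_, Or.inl ⟨hr.1, rfl⟩⟩
    · exact ⟨_, Or.inr ⟨hr.1, rfl⟩⟩
  constructor
  · intro a' b' ha hb
    have hb' := hb.eq_of_isQuad ⟨by omega, hlt, Or.inr hij, hjk, hr⟩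
    rcases ha.eq_of_isQuad ⟨p1, p2, p3, p4, Or.inr ⟨hlt, Or.inr hik, hjk⟩⟩ with h | ⟨-, rfl⟩
    · omega
    rcases hb' with ⟨h, rfl⟩ | ⟨h, rfl⟩ <;> simp only [Crosses] <;> omega
  · obtain ⟨⟨x', y'⟩, hd⟩ := hd
    refine ⟨(x', y'), fun ⟨x, y⟩ hc => ?_⟩
    have h0 := hc.lt
    have h1 := hc.crosses_left
    have h2 := hc.crosses_right
    have c1 := hc.not_crosses p3 (by simp only [ne_eq, Prod.mk.injEq]; omega)
      (by simp only [ne_eq, Prod.mk.injEq]; omega)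
    have c2 := hc.not_crosses p4 (by simp only [ne_eq, Prod.mk.injEq]; omega)
      (by simp only [ne_eq, Prod.mk.injEq]; omega)
    have c3 := hc.not_crosses hjk (by simp only [ne_eq, Prod.mk.injEq]; omega)
      (by simp only [ne_eq, Prod.mk.injEq]; omega)
    rcases hr with ⟨r1, r2, r3⟩ | ⟨r1, r2, r3⟩
    all_goals
      have c4 := hc.not_crosses r2 (by simp only [ne_eq, Prod.mk.injEq]; omega)
        (by simp only [ne_eq, Prod.mk.injEq]; omega)
      have c5 := hc.not_crosses r3 (by simp only [ne_eq, Prod.mk.injEq]; omega)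
        (by simp only [ne_eq, Prod.mk.injEq]; omega)
      simp only [Crosses, Prod.mk.injEq] at *
      omega

theorem isPentagon_right_top {i j k : Fin n} (hij : T.Edge i j)
    (hjk : (j, k) ∈ T.diagonals) (hik : (i, k) ∈ T.diagonals) : T.IsPentagon (j, k) (i, k) := by
  obtain ⟨q, q1, q2, q3, q4⟩ := Edge.exists_inner (Or.inr hjk) (two_le_of_mem hjk).1
  obtain ⟨r, hr⟩ := Edge.exists_outer (Or.inr hik) (two_le_of_mem hik).2
  have hlt := hij.lt
  have hd : ∃ c₀, (r < i ∧ c₀ = (r, q)) ∨ (k < r ∧ c₀ = (q, r)) := by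
    rcases hr with hr | hr
    · exact ⟨_, Or.inl ⟨hr.1, rfl⟩⟩
    · exact ⟨_, Or.inr ⟨hr.1, rfl⟩⟩
  constructor
  · intro a' b' ha hb
    have hb' := hb.eq_of_isQuad ⟨hlt, by omega, hij, Or.inr hjk, hr⟩
    rcases ha.eq_of_isQuad ⟨q1, q2, q3, q4, Or.inl ⟨hlt, hij, Or.inr hik⟩⟩ with ⟨-, rfl⟩ | h
    · rcases hb' with ⟨h, rfl⟩ | ⟨h, rfl⟩ <;> simp only [Crosses] <;> omega
    · omega
  · obtain ⟨⟨x', y'⟩, hd⟩ := hd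
    refine ⟨(x', y'), fun ⟨x, y⟩ hc => ?_⟩
    have h0 := hc.lt
    have h1 := hc.crosses_left
    have h2 := hc.crosses_right
    have c1 := hc.not_crosses q3 (by simp only [ne_eq, Prod.mk.injEq]; omega)
      (by simp only [ne_eq, Prod.mk.injEq]; omega)
    have c2 := hc.not_crosses q4 (by simp only [ne_eq, Prod.mk.injEq]; omega)
      (by simp only [ne_eq, Prod.mk.injEq]; omega)
    have c3 := hc.not_crosses hij (by simp only [ne_eq, Prod.mk.injEq]; omega)
      (by simp only [ne_eq, Prod.mk.injEq]; omega)
    rcases hr with ⟨r1, r2, r3⟩ | ⟨r1, r2, r3⟩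
    all_goals
      have c4 := hc.not_crosses r2 (by simp only [ne_eq, Prod.mk.injEq]; omega)
        (by simp only [ne_eq, Prod.mk.injEq]; omega)
      have c5 := hc.not_crosses r3 (by simp only [ne_eq, Prod.mk.injEq]; omega)
        (by simp only [ne_eq, Prod.mk.injEq]; omega)
      simp only [Crosses, Prod.mk.injEq] at *
      omega

theorem Neighbors.isPentagon {a b : Fin n × Fin n} (h : T.Neighbors a b)
    (ha : a ∈ T.diagonals) (hb : b ∈ T.diagonals) (hab : a ≠ b) : T.IsPentagon a b := by
  obtain ⟨⟨i, j, k⟩, ht, h1, h2⟩ := h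
  obtain ⟨e1, e2, e3⟩ := mem_triangles.1 ht
  simp only [triangleSides, Finset.mem_insert, Finset.mem_singleton] at h1 h2
  rcases h1 with rfl | rfl | rfl <;> rcases h2 with rfl | rfl | rfl
  · exact absurd rfl hab
  · exact isPentagon_left_right ha hb e3
  · exact isPentagon_left_top ha e2 hb
  · exact (isPentagon_left_right hb ha e3).symm
  · exact absurd rfl hab
  · exact isPentagon_right_top e1 ha hb
  · exact (isPentagon_left_top hb e2 ha).symm
  · exact (isPentagon_right_top e1 hb ha).symm
  · exact absurd rfl hab

theorem neighbors_iff_crosses {a b a' b' : Fin n × Fin n} (ha : T.IsFlip a a')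
    (hb : T.IsFlip b b') (hab : a ≠ b) : T.Neighbors a b ↔ Crosses a' b' :=
  ⟨fun h => (h.isPentagon ha.mem hb.mem hab).1 a' b' ha hb, neighbors_of_crosses ha hb hab⟩

theorem IsDoubleFlip.unique {a b c c' : Fin n × Fin n} (hN : T.Neighbors a b)
    (ha : a ∈ T.diagonals) (hb : b ∈ T.diagonals) (hab : a ≠ b) (h : T.IsDoubleFlip a b c)
    (h' : T.IsDoubleFlip a b c') : c = c' := by
  obtain ⟨c₀, hc⟩ := (hN.isPentagon ha hb hab).2
  rw [hc c h, hc c' h']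

end Triangulation
end Associahedron

/-! ### Counting triangles, ears and neighbouring pairs -/

namespace Associahedron

variable {n : ℕ}

namespace Triangulation

variable {T : Triangulation n}

theorem lt_of_mem_triangles {t : Fin n × Fin n × Fin n} (ht : t ∈ T.triangles) :
    t.1 < t.2.1 ∧ t.2.1 < t.2.2 := by
  obtain ⟨i, j, k⟩ := t
  exact ⟨(mem_triangles.1 ht).1.lt, (mem_triangles.1 ht).2.1.lt⟩

/-- Sending a triangle to its longest side is a bijection onto the diagonals together with the side
`(0, n - 1)`: two apices on the same side of one edge would produce crossing edges. -/
theorem card_triangles (T : Triangulation n) : T.triangles.card + 2 = n := by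
  classical
  have h3 := T.three_le
  let r : Fin n × Fin n := (⟨0, by omega⟩, ⟨n - 1, by omega⟩)
  have hrs : IsSide r := by simp only [IsSide, r, Fin.lt_def, true_and]; omega
  have hr : r ∉ T.diagonals := fun h => (T.isDiagonal _ h).2 hrs
  have hcard : T.triangles.card = (insert r T.diagonals).card := by
    refine Finset.card_bij (fun t _ => (t.1, t.2.2)) ?_ ?_ ?_
    · rintro ⟨i, j, k⟩ ht
      obtain ⟨h1, h2, h3⟩ := mem_triangles.1 ht
      rw [Finset.mem_insert]
      rcases h3 with h3 | h3
      · left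
        have := h1.lt
        have := h2.lt
        simp only [IsSide] at h3
        simp only [r, Prod.mk.injEq, Fin.ext_iff]
        omega
      · exact Or.inr h3
    · rintro ⟨i, j, k⟩ ht ⟨i', j', k'⟩ ht' h
      obtain ⟨h1, h2, -⟩ := mem_triangles.1 ht
      obtain ⟨h1', h2', -⟩ := mem_triangles.1 ht'
      simp only [Prod.mk.injEq] at h ⊢
      obtain ⟨rfl, rfl⟩ := h
      have c1 := h1.not_crosses h2'
      have c2 := h1'.not_crosses h2
      have := h1.lt
      have := h2.lt
      have := h1'.lt
      have := h2'.lt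
      simp only [Crosses] at c1 c2
      omega
    · intro e he
      obtain ⟨hE, hl⟩ : T.Edge e.1 e.2 ∧ e.1.val + 2 ≤ e.2.val := by
        rcases Finset.mem_insert.1 he with rfl | he
        · exact ⟨Or.inl hrs, by simp only [r]; omega⟩
        · exact ⟨Or.inr he, (two_le_of_mem he).1⟩
      obtain ⟨m, -, -, h1, h2⟩ := hE.exists_inner hl
      exact ⟨(e.1, m, e.2), mem_triangles.2 ⟨h1, h2, hE⟩, rfl⟩
  rw [hcard, Finset.card_insert_of_notMem hr]
  exact T.card_diagonals

theorem card_triangles_of_mem {e : Fin n × Fin n} (he : e ∈ T.diagonals) :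
    (T.triangles.filter fun t => e ∈ triangleSides t).card = 2 := by
  classical
  obtain ⟨i, j⟩ := e
  obtain ⟨m, k, h1, h2, h3, h4, h5⟩ := exists_isQuad he
  have hij : T.Edge i j := Or.inr he
  rcases h5 with ⟨h5, h6, h7⟩ | ⟨h5, h6, h7⟩
  · have : T.triangles.filter (fun t => (i, j) ∈ triangleSides t) = {(i, m, j), (k, i, j)} := by
      ext ⟨u, v, w⟩
      rw [Finset.mem_filter, mem_triangles]
      simp only [Finset.mem_insert, Finset.mem_singleton, Prod.mk.injEq, triangleSides]
      constructor
      · rintro ⟨⟨e1, e2, e3⟩, h⟩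
        have l1 := e1.lt
        have l2 := e2.lt
        rcases h with ⟨rfl, rfl⟩ | ⟨rfl, rfl⟩ | ⟨rfl, rfl⟩
        · have c1 := h7.not_crosses e3
          simp only [Crosses] at c1
          omega
        · have c1 := h7.not_crosses e1
          have c2 := e3.not_crosses h6
          simp only [Crosses] at c1 c2
          omega
        · have c1 := e1.not_crosses h4
          have c2 := h3.not_crosses e2
          simp only [Crosses] at c1 c2
          omega
      · rintro (⟨rfl, rfl, rfl⟩ | ⟨rfl, rfl, rfl⟩)
        · exact ⟨⟨h3, h4, hij⟩, by simp⟩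
        · exact ⟨⟨h6, hij, h7⟩, by simp⟩
    rw [this, Finset.card_pair]
    simp only [ne_eq, Prod.mk.injEq]
    omega
  · have : T.triangles.filter (fun t => (i, j) ∈ triangleSides t) = {(i, m, j), (i, j, k)} := by
      ext ⟨u, v, w⟩
      rw [Finset.mem_filter, mem_triangles]
      simp only [Finset.mem_insert, Finset.mem_singleton, Prod.mk.injEq, triangleSides]
      constructor
      · rintro ⟨⟨e1, e2, e3⟩, h⟩
        have l1 := e1.lt
        have l2 := e2.lt
        rcases h with ⟨rfl, rfl⟩ | ⟨rfl, rfl⟩ | ⟨rfl, rfl⟩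
        · have c1 := h6.not_crosses e2
          have c2 := e3.not_crosses h7
          simp only [Crosses] at c1 c2
          omega
        · have c1 := e3.not_crosses h6
          simp only [Crosses] at c1
          omega
        · have c1 := e1.not_crosses h4
          have c2 := h3.not_crosses e2
          simp only [Crosses] at c1 c2
          omega
      · rintro (⟨rfl, rfl, rfl⟩ | ⟨rfl, rfl, rfl⟩)
        · exact ⟨⟨h3, h4, hij⟩, by simp⟩
        · exact ⟨⟨hij, h7, h6⟩, by simp⟩
    rw [this, Finset.card_pair]
    simp only [ne_eq, Prod.mk.injEq]
    omega

/-- The sides of the triangle `t` that are diagonals of `T`. -/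
def diagonalSides (T : Triangulation n) (t : Fin n × Fin n × Fin n) : Finset (Fin n × Fin n) :=
  {e ∈ triangleSides t | e ∈ T.diagonals}

/-- Double counting of incidences: each diagonal borders exactly two triangles. -/
theorem sum_card_diagonalSides (T : Triangulation n) :
    ∑ t ∈ T.triangles, (T.diagonalSides t).card = 2 * T.diagonals.card := by
  classical
  have h := Finset.sum_card_bipartiteAbove_eq_sum_card_bipartiteBelow
    (s := T.triangles) (t := T.diagonals) (fun t e => e ∈ triangleSides t)
  replace h := h.trans (Finset.sum_congr rfl fun e he => card_triangles_of_mem (T := T) he)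
  rw [Finset.sum_const, smul_eq_mul, mul_comm] at h
  rw [← h]
  refine Finset.sum_congr rfl fun t _ => congrArg _ ?_
  ext e
  simp only [diagonalSides, Finset.bipartiteAbove, Finset.mem_filter]
  exact and_comm

theorem card_triangleSides {t : Fin n × Fin n × Fin n} (ht : t ∈ T.triangles) :
    (triangleSides t).card = 3 := by
  classical
  have := lt_of_mem_triangles ht
  unfold triangleSides
  rw [Finset.card_eq_three]
  refine ⟨_, _, _, ?_, ?_, ?_, rfl⟩ <;> simp only [ne_eq, Prod.mk.injEq] <;> omega

theorem card_filter_isSide_add {t : Fin n × Fin n × Fin n} (ht : t ∈ T.triangles) :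
    ((triangleSides t).filter IsSide).card + (T.diagonalSides t).card = 3 := by
  classical
  rw [← card_triangleSides ht, ← Finset.card_filter_add_card_filter_not (s := triangleSides t) IsSide]
  congr 2
  refine Finset.filter_congr fun e he => ?_
  constructor
  · exact fun h => (T.isDiagonal e h).2
  · intro h
    simp only [triangles, Finset.mem_filter] at ht
    exact (ht.2.2.2 e he).resolve_left h

theorem one_le_card_diagonalSides (hn : 4 ≤ n) {t : Fin n × Fin n × Fin n}
    (ht : t ∈ T.triangles) : 1 ≤ (T.diagonalSides t).card := by
  obtain ⟨i, j, k⟩ := t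
  rw [Nat.one_le_iff_ne_zero, Finset.card_ne_zero]
  by_contra hemp
  rw [Finset.not_nonempty_iff_eq_empty] at hemp
  obtain ⟨h1, h2, h3⟩ := mem_triangles.1 ht
  have l1 := h1.lt
  have l2 := h2.lt
  have key : ∀ e ∈ triangleSides (i, j, k), e ∉ T.diagonals := fun e he he' => by
    have : e ∈ T.diagonalSides (i, j, k) := Finset.mem_filter.2 ⟨he, he'⟩
    rw [hemp] at this
    exact absurd this (Finset.notMem_empty e)
  have s1 := h1.resolve_right (key _ (by simp [triangleSides]))
  have s2 := h2.resolve_right (key _ (by simp [triangleSides]))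
  have s3 := h3.resolve_right (key _ (by simp [triangleSides]))
  simp only [IsSide] at s1 s2 s3
  omega

theorem mem_ears_iff {t : Fin n × Fin n × Fin n} (ht : t ∈ T.triangles) :
    t ∈ T.ears ↔ (T.diagonalSides t).card = 1 := by
  have := card_filter_isSide_add ht
  simp only [ears, Finset.mem_filter, ht, true_and]
  omega

theorem card_ears (T : Triangulation n) :
    T.ears.card = ∑ t ∈ T.triangles, if (T.diagonalSides t).card = 1 then 1 else 0 := by
  rw [← Finset.card_filter]
  congr 1
  ext t
  rw [Finset.mem_filter]
  constructor
  · intro h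
    have ht : t ∈ T.triangles := (Finset.mem_filter.1 h).1
    exact ⟨ht, (mem_ears_iff ht).1 h⟩
  · exact fun h => (mem_ears_iff h.1).2 h.2

/-- Summing `k + [k = 1] ≥ 2` over the triangles gives `2(n - 3) + t₁ ≥ 2(n - 2)`. -/
theorem two_le_card_ears (hn : 4 ≤ n) (T : Triangulation n) : 2 ≤ T.ears.card := by
  have h : ∑ t ∈ T.triangles, 2 ≤ ∑ t ∈ T.triangles,
      ((T.diagonalSides t).card + if (T.diagonalSides t).card = 1 then 1 else 0) := by
    refine Finset.sum_le_sum fun t ht => ?_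
    have := one_le_card_diagonalSides hn ht
    split_ifs <;> omega
  rw [Finset.sum_add_distrib, ← card_ears, sum_card_diagonalSides, Finset.sum_const,
    smul_eq_mul] at h
  have := T.card_triangles
  have := T.card_diagonals
  omega

/-- The two-element sets of neighbouring diagonals of `T`. -/
def neighborPairs (T : Triangulation n) : Finset (Finset (Fin n × Fin n)) :=
  T.triangles.biUnion fun t => (T.diagonalSides t).powersetCard 2

theorem mem_neighborPairs {p : Finset (Fin n × Fin n)} :
    p ∈ T.neighborPairs ↔ ∃ a b, a ≠ b ∧ a ∈ T.diagonals ∧ b ∈ T.diagonals ∧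
      T.Neighbors a b ∧ p = {a, b} := by
  classical
  simp only [neighborPairs, Finset.mem_biUnion, Finset.mem_powersetCard, diagonalSides]
  constructor
  · rintro ⟨t, ht, hp, hc⟩
    obtain ⟨a, b, hab, rfl⟩ := Finset.card_eq_two.1 hc
    have ha := Finset.mem_filter.1 (hp (Finset.mem_insert_self a {b}))
    have hb := Finset.mem_filter.1 (hp (Finset.mem_insert_of_mem (Finset.mem_singleton_self b)))
    exact ⟨a, b, hab, ha.2, hb.2, ⟨t, ht, ha.1, hb.1⟩, rfl⟩
  · rintro ⟨a, b, hab, ha, hb, ⟨t, ht, hat, hbt⟩, rfl⟩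
    refine ⟨t, ht, ?_, Finset.card_pair hab⟩
    intro e he
    rcases Finset.mem_insert.1 he with rfl | he
    · exact Finset.mem_filter.2 ⟨hat, ha⟩
    · rw [Finset.mem_singleton.1 he]
      exact Finset.mem_filter.2 ⟨hbt, hb⟩

theorem eq_of_mem_triangleSides {t t' : Fin n × Fin n × Fin n} (ht : t ∈ T.triangles)
    (ht' : t' ∈ T.triangles) {a b : Fin n × Fin n} (hab : a ≠ b) (ha : a ∈ triangleSides t)
    (hb : b ∈ triangleSides t) (ha' : a ∈ triangleSides t') (hb' : b ∈ triangleSides t') :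
    t = t' := by
  have h1 := lt_of_mem_triangles ht
  have h2 := lt_of_mem_triangles ht'
  obtain ⟨i, j, k⟩ := t
  obtain ⟨i', j', k'⟩ := t'
  simp only [triangleSides, Finset.mem_insert, Finset.mem_singleton] at ha hb ha' hb'
  rcases ha with rfl | rfl | rfl <;> rcases hb with rfl | rfl | rfl <;>
    first
    | exact absurd rfl hab
    | simp only [Prod.mk.injEq, ne_eq] at *; omega

/-- Two sides determine their triangle, so each pair is counted once. Summing `k.choose 2 + 3 = 2k +
[k = 1]`, valid for `k = 1, 2, 3`, gives the total. -/
theorem card_neighborPairs (hn : 4 ≤ n) (T : Triangulation n) :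
    (T.neighborPairs.card : ℤ) = n - 6 + T.ears.card := by
  classical
  have hdisj : (T.triangles : Set (Fin n × Fin n × Fin n)).PairwiseDisjoint
      fun t => (T.diagonalSides t).powersetCard 2 := by
    intro t ht t' ht' hne
    refine Finset.disjoint_left.2 fun p hp hp' => hne ?_
    rw [Finset.mem_powersetCard] at hp hp'
    obtain ⟨a, b, hab, rfl⟩ := Finset.card_eq_two.1 hp.2
    have hsub : ∀ s, {a, b} ⊆ T.diagonalSides s → a ∈ triangleSides s ∧ b ∈ triangleSides s :=
      fun s hs => ⟨(Finset.mem_filter.1 (hs (by simp))).1, (Finset.mem_filter.1 (hs (by simp))).1⟩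
    exact eq_of_mem_triangleSides ht ht' hab (hsub t hp.1).1 (hsub t hp.1).2
      (hsub t' hp'.1).1 (hsub t' hp'.1).2
  have hcard : T.neighborPairs.card + ∑ t ∈ T.triangles, 3 = ∑ t ∈ T.triangles,
      (2 * (T.diagonalSides t).card + if (T.diagonalSides t).card = 1 then 1 else 0) := by
    rw [neighborPairs, Finset.card_biUnion hdisj, ← Finset.sum_add_distrib]
    refine Finset.sum_congr rfl fun t ht => ?_
    rw [Finset.card_powersetCard]
    have h1 := one_le_card_diagonalSides hn ht
    have h2 := card_filter_isSide_add ht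
    have h3 : (T.diagonalSides t).card ≤ 3 := by omega
    interval_cases (T.diagonalSides t).card <;> rfl
  rw [Finset.sum_add_distrib, ← Finset.mul_sum, ← card_ears, sum_card_diagonalSides,
    Finset.sum_const, smul_eq_mul] at hcard
  have := T.card_triangles
  have := T.card_diagonals
  omega

end Triangulation
end Associahedron

/-! ### Five-cycles as parametrised subgraphs -/

namespace Associahedron

section Pentagon

variable {V : Type*} {G : SimpleGraph V}

/-- The closed walk `v 0, …, v 4` of length five as a subgraph. -/
def pentagon (v : Fin 5 → V) (h : ∀ i, G.Adj (v i) (v (i + 1))) : G.Subgraph where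
  verts := Set.range v
  Adj x y := ∃ i, (x = v i ∧ y = v (i + 1)) ∨ (x = v (i + 1) ∧ y = v i)
  adj_sub := by
    rintro x y ⟨i, ⟨rfl, rfl⟩ | ⟨rfl, rfl⟩⟩
    exacts [h i, (h i).symm]
  edge_vert := by
    rintro x y ⟨i, ⟨rfl, rfl⟩ | ⟨rfl, rfl⟩⟩
    exacts [⟨i, rfl⟩, ⟨i + 1, rfl⟩]
  symm := ⟨by
    rintro x y ⟨i, ⟨rfl, rfl⟩ | ⟨rfl, rfl⟩⟩
    exacts [⟨i, Or.inr ⟨rfl, rfl⟩⟩, ⟨i, Or.inl ⟨rfl, rfl⟩⟩]⟩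

theorem cycleGraph_five_adj_iff {i j : Fin 5} :
    (SimpleGraph.cycleGraph 5).Adj i j ↔ j = i + 1 ∨ i = j + 1 := by
  revert i j
  decide

theorem pentagon_adj_iff {v : Fin 5 → V} {h : ∀ i, G.Adj (v i) (v (i + 1))}
    (hv : Function.Injective v) {i j : Fin 5} :
    (pentagon v h).Adj (v i) (v j) ↔ (SimpleGraph.cycleGraph 5).Adj i j := by
  rw [cycleGraph_five_adj_iff]
  constructor
  · rintro ⟨k, ⟨h1, h2⟩ | ⟨h1, h2⟩⟩
    · rw [hv h1, hv h2]; exact Or.inl rfl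
    · rw [hv h1, hv h2]; exact Or.inr rfl
  · rintro (rfl | rfl)
    · exact ⟨i, Or.inl ⟨rfl, rfl⟩⟩
    · exact ⟨j, Or.inr ⟨rfl, rfl⟩⟩

/-- Reversing the direction of travel keeps the subgraph: edge `i` of one walk is edge `-(i + 1)` of
the other. -/
theorem pentagon_comp_neg {v w : Fin 5 → V} (h : ∀ i, G.Adj (v i) (v (i + 1)))
    (h' : ∀ i, G.Adj (w i) (w (i + 1))) (hvw : ∀ i, w i = v (-i)) :
    pentagon v h = pentagon w h' := by
  have hvw' : ∀ i, v i = w (-i) := fun i => by rw [hvw, neg_neg]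
  refine SimpleGraph.Subgraph.ext ?_ ?_
  · ext x
    constructor
    · rintro ⟨i, rfl⟩
      exact ⟨-i, by rw [hvw, neg_neg]⟩
    · rintro ⟨i, rfl⟩
      exact ⟨-i, by rw [hvw]⟩
  · ext x y
    have key : ∀ (v w : Fin 5 → V), (∀ i, w i = v (-i)) → ∀ x y,
        (∃ i, (x = v i ∧ y = v (i + 1)) ∨ (x = v (i + 1) ∧ y = v i)) →
        ∃ i, (x = w i ∧ y = w (i + 1)) ∨ (x = w (i + 1) ∧ y = w i) := by
      rintro v w hvw x y ⟨i, h⟩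
      refine ⟨-(i + 1), ?_⟩
      rw [hvw, hvw, neg_neg,
        show -(-(i + 1) + 1) = i by rw [neg_add, neg_neg, add_neg_cancel_right]]
      exact h.elim (fun h => Or.inr h) (fun h => Or.inl h)
    exact ⟨key v w hvw x y, key w v hvw' x y⟩

theorem mem_cyclesThrough_five_iff {x : V} {H : G.Subgraph} :
    H ∈ cyclesThrough G 5 x ↔ ∃ (v : Fin 5 → V) (h : ∀ i, G.Adj (v i) (v (i + 1))),
      Function.Injective v ∧ v 0 = x ∧ H = pentagon v h := by
  constructor
  · rintro ⟨⟨f⟩, hx⟩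
    -- Rotating by the position `k` of `x` puts `x` at index `0`.
    let k := f ⟨x, hx⟩
    let v : Fin 5 → V := fun i => (f.symm (i + k)).1
    have hadj : ∀ i j, H.Adj (v i) (v j) ↔ (SimpleGraph.cycleGraph 5).Adj i j := by
      intro i j
      have : H.coe.Adj (f.symm (i + k)) (f.symm (j + k)) ↔ _ := f.symm.map_adj_iff
      rw [SimpleGraph.Subgraph.coe_adj] at this
      rw [this, SimpleGraph.cycleGraph_adj, SimpleGraph.cycleGraph_adj, add_sub_add_right_eq_sub,
        add_sub_add_right_eq_sub]
    have hinj : Function.Injective v := fun i j hij =>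
      add_right_cancel (f.symm.injective (Subtype.ext hij))
    have hsurj : ∀ y ∈ H.verts, ∃ i, v i = y := fun y hy =>
      ⟨f ⟨y, hy⟩ - k, by simp only [v, sub_add_cancel, RelIso.symm_apply_apply]⟩
    have h : ∀ i, G.Adj (v i) (v (i + 1)) := fun i =>
      ((hadj i (i + 1)).2 (cycleGraph_five_adj_iff.2 (Or.inl rfl))).adj_sub
    refine ⟨v, h, hinj, by simp only [v, k, zero_add, RelIso.symm_apply_apply], ?_⟩
    refine SimpleGraph.Subgraph.ext ?_ ?_
    · ext y
      exact ⟨fun hy => hsurj y hy, by rintro ⟨i, rfl⟩; exact (f.symm (i + k)).2⟩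
    · ext y z
      constructor
      · intro hyz
        obtain ⟨i, rfl⟩ := hsurj y hyz.fst_mem
        obtain ⟨j, rfl⟩ := hsurj z hyz.snd_mem
        exact (pentagon_adj_iff hinj).2 ((hadj i j).1 hyz)
      · intro hyz
        obtain ⟨i, rfl⟩ := (pentagon v h).edge_vert hyz
        obtain ⟨j, rfl⟩ := (pentagon v h).edge_vert hyz.symm
        exact (hadj i j).2 ((pentagon_adj_iff hinj).1 hyz)
  · rintro ⟨v, h, hinj, rfl, rfl⟩
    refine ⟨⟨SimpleGraph.Iso.symm ⟨Equiv.ofInjective v hinj, ?_⟩⟩, ⟨0, rfl⟩⟩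
    intro i j
    exact pentagon_adj_iff (h := h) hinj

end Pentagon

/-! ### Edges of the flip graph are flips -/

variable {n : ℕ}

namespace Triangulation

variable {T S : Triangulation n}

/-- The triangulation in which the diagonal `a` of `T` is replaced by `d`. -/
def IsFlip.replace {a d : Fin n × Fin n} (h : T.IsFlip a d) : Triangulation n where
  diagonals := insert d (T.diagonals.erase a)
  isDiagonal e he := by
    rcases Finset.mem_insert.1 he with rfl | he
    exacts [h.isDiagonal, T.isDiagonal e (Finset.mem_of_mem_erase he)]
  not_crosses e he f hf := by
    have key : ∀ e ∈ T.diagonals.erase a, ¬ Crosses d e := fun e he hc =>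
      Finset.ne_of_mem_erase he (h.eq_of_crosses e (Finset.mem_of_mem_erase he) hc)
    rcases Finset.mem_insert.1 he with he | he <;> rcases Finset.mem_insert.1 hf with hf | hf
    · rw [he, hf]; exact not_crosses_self d
    · rw [he]; exact key f hf
    · rw [hf]; exact fun hc => key e he hc.symm
    · exact T.not_crosses e (Finset.mem_of_mem_erase he) f (Finset.mem_of_mem_erase hf)
  card_diagonals := by
    rw [Finset.card_insert_of_notMem fun hd => h.notMem (Finset.mem_of_mem_erase hd),
      Finset.card_erase_add_one h.mem]
    exact T.card_diagonals

open Classical in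
/-- The flip of the diagonal `a` of `T`. -/
noncomputable def flip (T : Triangulation n) (a : Fin n × Fin n) : Triangulation n :=
  if h : a ∈ T.diagonals then (exists_isFlip h).choose_spec.replace else T

theorem IsFlip.diagonals_flip {a d : Fin n × Fin n} (h : T.IsFlip a d) :
    (T.flip a).diagonals = insert d (T.diagonals.erase a) := by
  have hd := h.unique (exists_isFlip h.mem).choose_spec
  rw [flip, dif_pos h.mem]
  exact congrArg (insert · (T.diagonals.erase a)) hd.symm

theorem IsFlip.mem_flip {a d e : Fin n × Fin n} (h : T.IsFlip a d) :
    e ∈ (T.flip a).diagonals ↔ e = d ∨ (e ≠ a ∧ e ∈ T.diagonals) := by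
  rw [h.diagonals_flip, Finset.mem_insert, Finset.mem_erase]

theorem IsFlip.ne {a d : Fin n × Fin n} (h : T.IsFlip a d) : d ≠ a :=
  fun hd => h.notMem (hd ▸ h.mem)

theorem IsFlip.notMem_flip {a d : Fin n × Fin n} (h : T.IsFlip a d) :
    a ∉ (T.flip a).diagonals := fun ha =>
  (h.mem_flip.1 ha).elim (fun h' => h.ne h'.symm) (fun h' => h'.1 rfl)

theorem IsFlip.symm {a d : Fin n × Fin n} (h : T.IsFlip a d) : (T.flip a).IsFlip d a where
  mem := h.mem_flip.2 (Or.inl rfl)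
  isDiagonal := T.isDiagonal a h.mem
  notMem := h.notMem_flip
  eq_of_crosses e he hc := (h.mem_flip.1 he).resolve_right
    fun he => T.not_crosses a h.mem e he.2 hc

theorem IsFlip.flip_flip {a d : Fin n × Fin n} (h : T.IsFlip a d) : (T.flip a).flip d = T := by
  ext e : 2
  have := h.notMem
  have := h.mem
  rw [h.symm.mem_flip, h.mem_flip]
  grind

/-- Each triangulation has one private diagonal, `a` in `T` and `d` in `S`. As `d` crosses nothing
in `S`, it can cross only `a` in `T`. -/
theorem exists_isFlip_of_adj (h : (flipGraph n).Adj T S) :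
    ∃ a d, T.IsFlip a d ∧ S = T.flip a := by
  obtain ⟨-, h⟩ := h
  have hT := T.card_diagonals
  have hS := S.card_diagonals
  have h1 : (T.diagonals \ S.diagonals).card = 1 := by
    have := Finset.card_sdiff_add_card_inter T.diagonals S.diagonals
    rw [Finset.inter_comm] at h
    rw [Finset.inter_comm] at this
    omega
  have h2 : (S.diagonals \ T.diagonals).card = 1 := by
    have := Finset.card_sdiff_add_card_inter S.diagonals T.diagonals
    rw [Finset.inter_comm] at h
    omega
  obtain ⟨a, ha⟩ := Finset.card_eq_one.1 h1
  obtain ⟨d, hd⟩ := Finset.card_eq_one.1 h2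
  have ha' : ∀ e, (e ∈ T.diagonals ∧ e ∉ S.diagonals) ↔ e = a := fun e => by
    rw [← Finset.mem_sdiff, ha, Finset.mem_singleton]
  have hd' : ∀ e, (e ∈ S.diagonals ∧ e ∉ T.diagonals) ↔ e = d := fun e => by
    rw [← Finset.mem_sdiff, hd, Finset.mem_singleton]
  have hf : T.IsFlip a d :=
    { mem := ((ha' a).2 rfl).1
      isDiagonal := S.isDiagonal d ((hd' d).2 rfl).1
      notMem := ((hd' d).2 rfl).2
      eq_of_crosses := fun e he hc =>
        (ha' e).1 ⟨he, fun he' => S.not_crosses d ((hd' d).2 rfl).1 e he' hc⟩ }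
  refine ⟨a, d, hf, ?_⟩
  ext e : 2
  have := ha' e
  have := hd' e
  rw [hf.mem_flip]
  tauto

theorem IsFlip.adj_flip {a d : Fin n × Fin n} (h : T.IsFlip a d) :
    (flipGraph n).Adj T (T.flip a) := by
  refine ⟨fun hT => h.notMem_flip (hT ▸ h.mem), ?_⟩
  have : T.diagonals ∩ (T.flip a).diagonals = T.diagonals.erase a := by
    ext e
    have := h.notMem
    rw [Finset.mem_inter, h.mem_flip, Finset.mem_erase]
    grind
  rw [this]
  have := Finset.card_erase_add_one h.mem
  have := T.card_diagonals
  omega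

/-- Two triangulations which differ only in one diagonal each are adjacent. -/
theorem adj_of_forall {c : Fin n × Fin n} (hc : c ∈ T.diagonals) (hcS : c ∉ S.diagonals)
    (h : ∀ e, e ≠ c → e ∈ T.diagonals → e ∈ S.diagonals) : (flipGraph n).Adj T S := by
  refine ⟨fun hT => hcS (hT ▸ hc), ?_⟩
  have : T.diagonals ∩ S.diagonals = T.diagonals.erase c := by
    ext e
    rw [Finset.mem_inter, Finset.mem_erase]
    constructor
    · exact fun he => ⟨fun h' => hcS (h' ▸ he.2), he.1⟩
    · exact fun he => ⟨he.2, h e he.1 he.2⟩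
  rw [this]
  have := Finset.card_erase_add_one hc
  have := T.card_diagonals
  omega

end Triangulation
end Associahedron

/-! ### Five-cycles through a triangulation -/

namespace Associahedron

variable {n : ℕ}

namespace Triangulation

variable {T : Triangulation n} {a b a' b' c' d' : Fin n × Fin n}

theorem ext_mem {S T : Triangulation n} (h : ∀ e, e ∈ S.diagonals ↔ e ∈ T.diagonals) : S = T :=
  Triangulation.ext (Finset.ext h)

theorem IsFlip.mem_flip_of_ne (ha : T.IsFlip a a') (hb : b ∈ T.diagonals) (hab : a ≠ b) :
    b ∈ (T.flip a).diagonals :=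
  ha.mem_flip.2 (Or.inr ⟨hab.symm, hb⟩)

theorem mem_flip_flip (ha : T.IsFlip a a') (hc : (T.flip a).IsFlip b c') {e : Fin n × Fin n} :
    e ∈ ((T.flip a).flip b).diagonals ↔
      e = c' ∨ (e ≠ b ∧ (e = a' ∨ (e ≠ a ∧ e ∈ T.diagonals))) := by
  rw [hc.mem_flip, ha.mem_flip]

/-- If two paths of length two in the flip graph that start at `T` with different flips end at
adjacent triangulations, then the second flip of each is the first flip of the other. -/
theorem eq_of_adj_flip_flip {c d : Fin n × Fin n} (ha : T.IsFlip a a') (hb : T.IsFlip b b')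
    (hab : a ≠ b) (hc : (T.flip a).IsFlip c c') (hd : (T.flip b).IsFlip d d')
    (hca : c ≠ a') (hdb : d ≠ b')
    (h : (flipGraph n).Adj ((T.flip a).flip c) ((T.flip b).flip d)) : c = b := by
  by_contra hcb
  obtain ⟨x, y, hxy, hS⟩ := exists_isFlip_of_adj h
  have hm : ∀ e, e ∈ ((T.flip b).flip d).diagonals ↔
      e = y ∨ (e ≠ x ∧ e ∈ ((T.flip a).flip c).diagonals) := fun e => by
    rw [hS, hxy.mem_flip]
  have hb2 : b ∈ ((T.flip a).flip c).diagonals :=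
    (mem_flip_flip ha hc).2 (Or.inr ⟨Ne.symm hcb, Or.inr ⟨hab.symm, hb.mem⟩⟩)
  have hb3 : b' ∈ ((T.flip b).flip d).diagonals :=
    (mem_flip_flip hb hd).2 (Or.inr ⟨hdb.symm, Or.inl rfl⟩)
  have hb2' : b' ∉ ((T.flip a).flip c).diagonals :=
    fun h' => Triangulation.not_crosses _ _ h' _ hb2 hb.crosses
  have hb3' : b ∉ ((T.flip b).flip d).diagonals :=
    fun h' => Triangulation.not_crosses _ _ hb3 _ h' hb.crosses
  -- If `c ≠ b`, the first end keeps `b` and the second contains `b'`, which crosses it; the flip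
  -- joining the ends therefore exchanges `b` for `b'`.
  have hyb : b' = y := ((hm b').1 hb3).resolve_right fun h' => hb2' h'.2
  have hxb : b = x := by
    by_contra hne
    exact hb3' ((hm b).2 (Or.inr ⟨hne, hb2⟩))
  -- So `a'` survives in the second end, and `a`, which it crosses, must have been removed there: `d
  -- = a`.
  have ha3 : a' ∈ ((T.flip b).flip d).diagonals := by
    refine (hm a').2 (Or.inr ⟨fun h' => ha.notMem ?_, (mem_flip_flip ha hc).2
      (Or.inr ⟨hca.symm, Or.inl rfl⟩)⟩)
    rw [h', ← hxb]
    exact hb.mem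
  have had : a = d := by
    by_contra hne
    refine Triangulation.not_crosses _ _ ha3 a ?_ ha.crosses
    exact (mem_flip_flip hb hd).2 (Or.inr ⟨hne, Or.inr ⟨hab, ha.mem⟩⟩)
  -- Now `c` is a diagonal of `T` other than `a` and `b`, so it lies in the second end. Only `b'` is
  -- new there, so `c` also lies in the first end, from which it was flipped away.
  obtain ⟨hc1, hc2⟩ := (ha.mem_flip.1 hc.mem).resolve_left hca
  have hc3 : c ∈ ((T.flip b).flip d).diagonals :=
    (mem_flip_flip hb hd).2 (Or.inr ⟨had ▸ hc1, Or.inr ⟨hcb, hc2⟩⟩)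
  rcases (hm c).1 hc3 with h' | ⟨-, h'⟩
  · exact hb.notMem (hyb ▸ h' ▸ hc2)
  · exact hc.notMem_flip h'

/-- When `b'` does not cross `a'`, it still replaces `b` after the flip of `a`, and symmetrically,
so both orders exchange `a, b` for `a', b'`. -/
theorem flip_comm_of_not_crosses (ha : T.IsFlip a a') (hb : T.IsFlip b b') (hab : a ≠ b)
    (h : ¬ Crosses a' b') : (T.flip a).flip b = (T.flip b).flip a := by
  have key : ∀ {a b a' b' : Fin n × Fin n}, T.IsFlip a a' → T.IsFlip b b' → a ≠ b →
      ¬ Crosses b' a' → (T.flip a).IsFlip b b' := fun {a b a' b'} ha hb hab h =>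
    { mem := ha.mem_flip_of_ne hb.mem hab
      isDiagonal := hb.isDiagonal
      notMem := fun hm => (ha.mem_flip.1 hm).elim
        (fun h' => hab (ha.eq_of_eq (h' ▸ hb))) (fun h' => hb.notMem h'.2)
      eq_of_crosses := fun e he hc => (ha.mem_flip.1 he).elim (fun h' => absurd (h' ▸ hc) h)
        (fun h' => hb.eq_of_crosses e h'.2 hc) }
  have h1 := key ha hb hab fun h' => h h'.symm
  have h2 := key hb ha hab.symm h
  have h3 : a' ≠ b := fun h' => ha.notMem (h' ▸ hb.mem)
  have h4 : b' ≠ a := fun h' => hb.notMem (h' ▸ ha.mem)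
  refine ext_mem fun e => ?_
  rw [mem_flip_flip ha h1, mem_flip_flip hb h2]
  grind

/-- Flipping `b` after flipping the neighbouring diagonal `a` gives a diagonal that crosses
both. -/
theorem isDoubleFlip_of_crosses (ha : T.IsFlip a a') (hb : T.IsFlip b b')
    (h : Crosses a' b') (hc : (T.flip a).IsFlip b c') : T.IsDoubleFlip a b c' := by
  have heq : ∀ e ∈ T.diagonals, Crosses c' e → e = a ∨ e = b := fun e he hce => by
    by_cases hea : e = a
    · exact Or.inl hea
    · exact Or.inr (hc.eq_of_crosses e (ha.mem_flip.2 (Or.inr ⟨hea, he⟩)) hce)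
  have hac : a' ∈ ((T.flip a).flip b).diagonals :=
    (mem_flip_flip ha hc).2 (Or.inr ⟨fun h' => ha.notMem (h' ▸ hb.mem), Or.inl rfl⟩)
  have hcc : c' ∈ ((T.flip a).flip b).diagonals := (mem_flip_flip ha hc).2 (Or.inl rfl)
  have hcT : c' ∉ T.diagonals := fun h' => by
    have : c' ≠ a := fun h'' => Triangulation.not_crosses _ _ hac _ hcc (h'' ▸ ha.crosses)
    exact hc.notMem (ha.mem_flip.2 (Or.inr ⟨this, h'⟩))
  refine ⟨hc.isDiagonal.1, ?_, hc.crosses, heq⟩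
  -- If `c'` missed `a`, it would be the flip `b'` of `b` in `T`; but `c'` shares a triangulation
  -- with `a'`, which crosses `b'`.
  by_contra hca
  have hflip : T.IsFlip b c' := ⟨hb.mem, hc.isDiagonal, hcT, fun e he hce =>
    (heq e he hce).resolve_left fun h' => hca (h' ▸ hce)⟩
  rw [← hflip.unique hb] at h
  exact Triangulation.not_crosses _ _ hac _ hcc h

/-- The cyclic sequence of triangulations obtained by flipping in turn `a` and `b`. -/
noncomputable def flipCycle (T : Triangulation n) (a b : Fin n × Fin n) :
    Fin 5 → Triangulation n :=
  ![T, T.flip a, (T.flip a).flip b, (T.flip b).flip a, T.flip b]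

/-- Both double flips insert a diagonal crossing `a` and `b` only, hence the same one. They then
differ just in `a'` against `b'`, which closes the cycle. -/
theorem Neighbors.adj_flipCycle (h : T.Neighbors a b) (hma : a ∈ T.diagonals)
    (hmb : b ∈ T.diagonals) (hab : a ≠ b) :
    (∀ i, (flipGraph n).Adj (T.flipCycle a b i) (T.flipCycle a b (i + 1))) ∧
      Function.Injective (T.flipCycle a b) := by
  obtain ⟨a', ha⟩ := exists_isFlip hma
  obtain ⟨b', hb⟩ := exists_isFlip hmb
  obtain ⟨c', hc⟩ := exists_isFlip (ha.mem_flip_of_ne hmb hab)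
  obtain ⟨d', hd⟩ := exists_isFlip (hb.mem_flip_of_ne hma hab.symm)
  have hcr := (neighbors_iff_crosses ha hb hab).1 h
  have hcd := (isDoubleFlip_of_crosses ha hb hcr hc).unique h hma hmb hab
    (isDoubleFlip_of_crosses hb ha hcr.symm hd).symm
  subst hcd
  have hab' : a' ≠ b' := fun h' => hab (ha.eq_of_eq (h' ▸ hb))
  have haT := ha.notMem
  have hbT := hb.notMem
  have m1 : ∀ e, e ∈ (T.flip a).diagonals ↔ _ := fun e => ha.mem_flip
  have m4 : ∀ e, e ∈ (T.flip b).diagonals ↔ _ := fun e => hb.mem_flip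
  have m2 : ∀ e, e ∈ ((T.flip a).flip b).diagonals ↔ _ := fun e => mem_flip_flip ha hc
  have m3 : ∀ e, e ∈ ((T.flip b).flip a).diagonals ↔ _ := fun e => mem_flip_flip hb hd
  have n1 := hc.notMem
  have n2 := hd.notMem
  have a23 : (flipGraph n).Adj ((T.flip a).flip b) ((T.flip b).flip a) := by
    refine adj_of_forall (c := a') ((m2 a').2 ?_) (fun h' => ?_) fun e he h' => ?_
    · grind
    · have := (m3 a').1 h'
      have := (m1 c')
      grind
    · rw [m2] at h'
      rw [m3]
      grind
  have a01 := ha.adj_flip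
  have a12 := hc.adj_flip
  have a34 := hd.adj_flip.symm
  have a40 := hb.adj_flip.symm
  have k0 : a ∉ (T.flip a).diagonals := ha.notMem_flip
  have k1 : a ∉ ((T.flip a).flip b).diagonals := fun h' =>
    Triangulation.not_crosses _ a' ((m2 a').2 (by grind)) a h' ha.crosses
  have k2 : b ∉ ((T.flip b).flip a).diagonals := fun h' =>
    Triangulation.not_crosses _ b' ((m3 b').2 (by grind)) b h' hb.crosses
  have k3 : a ∈ (T.flip b).diagonals := hb.mem_flip_of_ne hma hab.symm
  have k4 : b ∈ (T.flip a).diagonals := ha.mem_flip_of_ne hmb hab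
  refine ⟨?_, ?_⟩
  · intro i
    fin_cases i
    exacts [a01, a12, a23, a34, a40]
  · have e02 : T ≠ (T.flip a).flip b := fun h' => k1 (h' ▸ hma)
    have e03 : T ≠ (T.flip b).flip a := fun h' => k2 (h' ▸ hmb)
    have e13 : T.flip a ≠ (T.flip b).flip a := fun h' => k2 (h' ▸ k4)
    have e14 : T.flip a ≠ T.flip b := fun h' => k0 (h' ▸ k3)
    have e24 : (T.flip a).flip b ≠ T.flip b := fun h' => k1 (h' ▸ k3)
    have f01 := a01.ne
    have f12 := a12.ne
    have f23 := a23.ne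
    have f34 := a34.ne
    have f40 := a40.ne
    intro i j hij
    fin_cases i <;> fin_cases j <;> first | rfl | exact absurd hij ‹_› | exact absurd hij.symm ‹_›

theorem exists_eq_flipCycle {v : Fin 5 → Triangulation n}
    (h : ∀ i, (flipGraph n).Adj (v i) (v (i + 1))) (hv : Function.Injective v) (h0 : v 0 = T) :
    ∃ a b, a ∈ T.diagonals ∧ b ∈ T.diagonals ∧ a ≠ b ∧ T.Neighbors a b ∧
      v = T.flipCycle a b := by
  subst h0
  obtain ⟨a, a', ha, h1⟩ := exists_isFlip_of_adj (h 0)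
  obtain ⟨b, b', hb, h4⟩ := exists_isFlip_of_adj (h 4).symm
  obtain ⟨c, c', hc, h2⟩ := exists_isFlip_of_adj (h 1)
  obtain ⟨d, d', hd, h3⟩ := exists_isFlip_of_adj (h 3).symm
  have h23 := h 2
  simp only [Fin.reduceAdd, Fin.isValue, zero_add] at h1 h2 h3 h4 h23 hb hd hc
  have hb : (v 0).IsFlip b b' := hb
  have h4 : v 4 = (v 0).flip b := h4
  rw [h1] at hc h2
  rw [h4] at hd h3
  have hab : a ≠ b := fun h' => absurd (hv (h1.trans (h' ▸ h4.symm))) (by decide)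
  -- Flipping `a'` back would return to `v 0`, against injectivity.
  have hca : c ≠ a' := fun h' => by
    rw [h', ha.flip_flip] at h2
    exact absurd (hv h2) (by decide)
  have hdb : d ≠ b' := fun h' => by
    rw [h', hb.flip_flip] at h3
    exact absurd (hv h3) (by decide)
  rw [h2, h3] at h23
  obtain rfl := eq_of_adj_flip_flip ha hb hab hc hd hca hdb h23
  obtain rfl := eq_of_adj_flip_flip hb ha hab.symm hd hc hdb hca h23.symm
  refine ⟨_, _, ha.mem, hb.mem, hab, ?_, ?_⟩
  · rw [neighbors_iff_crosses ha hb hab]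
    by_contra hcr
    exact h23.ne (flip_comm_of_not_crosses ha hb hab hcr)
  · funext i
    fin_cases i
    exacts [rfl, h1, h2, h3, h4]

open Classical in
/-- The diagonals of `T` that are flipped in the edges of `H` at `T`. -/
noncomputable def flippedDiagonals (T : Triangulation n) (H : (flipGraph n).Subgraph) :
    Finset (Fin n × Fin n) :=
  {e ∈ T.diagonals | ∃ S, H.Adj T S ∧ e ∉ S.diagonals}

theorem flippedDiagonals_pentagon (hma : a ∈ T.diagonals) (hmb : b ∈ T.diagonals)
    (h : ∀ i, (flipGraph n).Adj (T.flipCycle a b i) (T.flipCycle a b (i + 1)))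
    (hinj : Function.Injective (T.flipCycle a b)) :
    T.flippedDiagonals (pentagon _ h) = {a, b} := by
  obtain ⟨a', ha⟩ := exists_isFlip hma
  obtain ⟨b', hb⟩ := exists_isFlip hmb
  have hmem : ∀ {a a' e : Fin n × Fin n}, T.IsFlip a a' → e ∈ T.diagonals →
      (e ∉ (T.flip a).diagonals ↔ e = a) := fun {a a' e} ha he => by
    constructor
    · intro h'
      by_contra hne
      exact h' (ha.mem_flip.2 (Or.inr ⟨hne, he⟩))
    · rintro rfl
      exact ha.notMem_flip
  have hadj : ∀ S, (pentagon _ h).Adj T S ↔ S = T.flip a ∨ S = T.flip b := fun S => by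
    constructor
    · intro hS
      obtain ⟨j, rfl⟩ := (pentagon _ h).edge_vert hS.symm
      have : (SimpleGraph.cycleGraph 5).Adj 0 j := (pentagon_adj_iff (h := h) hinj).1 hS
      fin_cases j
      · exact absurd this (by decide)
      · exact Or.inl rfl
      · exact absurd this (by decide)
      · exact absurd this (by decide)
      · exact Or.inr rfl
    · rintro (rfl | rfl)
      · exact ⟨0, Or.inl ⟨rfl, rfl⟩⟩
      · exact ⟨4, Or.inr ⟨rfl, rfl⟩⟩
  ext e
  simp only [flippedDiagonals, Finset.mem_filter, hadj, Finset.mem_insert, Finset.mem_singleton,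
    or_and_right, exists_or, exists_eq_left]
  constructor
  · rintro ⟨he, h'⟩
    rwa [hmem ha he, hmem hb he] at h'
  · intro h'
    have he : e ∈ T.diagonals := by rcases h' with rfl | rfl <;> assumption
    rw [hmem ha he, hmem hb he]
    exact ⟨he, h'⟩

theorem bijOn_flippedDiagonals (T : Triangulation n) :
    Set.BijOn T.flippedDiagonals (cyclesThrough (flipGraph n) 5 T) T.neighborPairs := by
  have hrep : ∀ H ∈ cyclesThrough (flipGraph n) 5 T, ∃ (a b : Fin n × Fin n)
      (h : ∀ i, (flipGraph n).Adj (T.flipCycle a b i) (T.flipCycle a b (i + 1))),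
      a ≠ b ∧ a ∈ T.diagonals ∧ b ∈ T.diagonals ∧ T.Neighbors a b ∧ H = pentagon _ h ∧
        T.flippedDiagonals H = {a, b} := by
    intro H hH
    obtain ⟨v, h, hv, h0, rfl⟩ := mem_cyclesThrough_five_iff.1 hH
    obtain ⟨a, b, ha, hb, hab, hN, rfl⟩ := exists_eq_flipCycle h hv h0
    exact ⟨a, b, h, hab, ha, hb, hN, rfl, flippedDiagonals_pentagon ha hb h hv⟩
  refine ⟨?_, ?_, ?_⟩
  · intro H hH
    obtain ⟨a, b, h, hab, ha, hb, hN, -, hF⟩ := hrep H hH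
    exact mem_neighborPairs.2 ⟨a, b, hab, ha, hb, hN, hF⟩
  · intro H hH H' hH' heq
    obtain ⟨a, b, h, hab, ha, hb, hN, hHe, hF⟩ := hrep H hH
    obtain ⟨c, d, h', hcd, hc, hd, hN', hHe', hF'⟩ := hrep H' hH'
    rw [hF, hF'] at heq
    rw [hHe, hHe']
    have heq' : (({a, b} : Finset (Fin n × Fin n)) : Set (Fin n × Fin n)) = {c, d} := by
      rw [heq]; simp
    rw [Finset.coe_pair, Set.pair_eq_pair_iff] at heq'
    rcases heq' with ⟨rfl, rfl⟩ | ⟨rfl, rfl⟩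
    · rfl
    -- Exchanging `a` and `b` reverses the cycle.
    · refine pentagon_comp_neg h h' fun i => ?_
      fin_cases i <;> rfl
  · intro p hp
    obtain ⟨a, b, hab, ha, hb, hN, rfl⟩ := mem_neighborPairs.1 hp
    obtain ⟨h, hinj⟩ := hN.adj_flipCycle ha hb hab
    exact ⟨pentagon _ h, mem_cyclesThrough_five_iff.2 ⟨_, h, hinj, rfl, rfl⟩,
      flippedDiagonals_pentagon ha hb h hinj⟩

end Triangulation
end Associahedron

theorem proposition3p2 (n : ℕ) (hn : 5 ≤ n) (T : Associahedron.Triangulation n) :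
    ((Associahedron.cyclesThrough (Associahedron.flipGraph n) 5 T).ncard : ℤ)
        = (n : ℤ) - 6 + (T.ears.card : ℤ) ∧
      (n : ℤ) - 6 + (T.ears.card : ℤ) ≥ (n : ℤ) - 4 := by
  have h := T.two_le_card_ears (by omega)
  refine ⟨?_, by omega⟩
  rw [T.bijOn_flippedDiagonals.ncard_eq, Set.ncard_coe_finset, T.card_neighborPairs (by omega)]
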